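/- Let $d\ge 2$ be an integer. A $d$-ary tree is a finite rooted tree (possibly a single vertex) in which every internal vertex has at least two and at most $d$ children; $\|T\|$ denotes the number of leaves of $T$. A nonempty set $S$ of leaves of a $d$-ary tree $T$ induces a $d$-ary tree as follows: take the smallest subtree of $T$ containing all leaves in $S$, and then suppress all vertices with exactly one child. For $d$-ary trees $D$ and $T$, let $c(D,T)$ be the number of sets of $\|D\|$ leaves of $T$ that induce a tree isomorphic to $D$ (as a rooted tree), and let $\gamma(D,T)=c(D,T)/\binom{\|T\|}{\|D\|}$ when $\|T\|\ge\|D\|$. The $d$-ary inducibility of $D$ is $$I_d(D)=\limsup_{n\to\infty}\ \max_{\substack{\|T\|=n\\ T\ d\text{-ary tree}}}\gamma(D,T).$$ The even $d$-ary tree $E_k^d$ with $k\ge 1$ leaves is defined recursively: $E_1^d$ is a single vertex; for $2\le k\le d$, $E_k^d$ is a star, consisting of the root and $k$ leaves; for $k>d$, write $k=ds+b$ with $b\in\{0,1,\dots,d-1\}$, and let $E_k^d$ be the tree whose root has exactly $d$ branches, namely $d-b$ copies of $E_s^d$ and $b$ copies of $E_{s+1}^d$. Define constants $c_k$ by $c_0=c_1=1$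 and $$c_{ds+b}=\binom{d}{b}\,\frac{c_s^{\,d-b}\,c_{s+1}^{\,b}}{d^{\,ds+b}-d}$$ for all integers $s\ge 0$ and $b\in\{0,1,\dots,d-1\}$ with $ds+b\ge 2$. (When $b=0$ the factor $c_{s+1}^{\,b}$ is $1$.) Then for every $k\ge 1$, the $d$-ary inducibility of $E_k^d$ is $$I_d(E_k^d)=k!\,c_k.$$ -/

import Mathlib

/-- Finite rooted trees. The order in which the children of a vertex are listed is immaterial:
trees are compared through `RTree.Iso`. -/
inductive RTree : Type
  | leaf : RTree
  | node (n : ℕ) (children : Fin n → RTree) : RTree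

namespace RTree

/-- `T` is a `d`-ary tree: every internal vertex has at least two and at most `d` children. -/
def IsDary (d : ℕ) : RTree → Prop
  | leaf => True
  | node n c => 2 ≤ n ∧ n ≤ d ∧ ∀ i, (c i).IsDary d

/-- Isomorphism of rooted trees: a bijection between the children of the two roots such that
corresponding branches are isomorphic. -/
inductive Iso : RTree → RTree → Prop
  | leaf : Iso leaf leaf
  | node {n m : ℕ} {c : Fin n → RTree} {c' : Fin m → RTree} (e : Fin n ≃ Fin m)
      (h : ∀ i, Iso (c i) (c' (e i))) : Iso (node n c) (node m c')

/-- The type of leaves of `T`: a leaf of `node n c` is a leaf of one of the branches `c i`. -/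
def Leaves : RTree → Type
  | leaf => Unit
  | node n c => Σ i : Fin n, (c i).Leaves

instance instFintypeLeaves : (T : RTree) → Fintype T.Leaves
  | leaf => inferInstanceAs (Fintype Unit)
  | node n c =>
    haveI : ∀ i, Fintype (c i).Leaves := fun i => instFintypeLeaves (c i)
    inferInstanceAs (Fintype (Σ i : Fin n, (c i).Leaves))

instance instDecidableEqLeaves : (T : RTree) → DecidableEq T.Leaves
  | leaf => inferInstanceAs (DecidableEq Unit)
  | node n c =>
    haveI : ∀ i, DecidableEq (c i).Leaves := fun i => instDecidableEqLeaves (c i)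
    inferInstanceAs (DecidableEq (Σ i : Fin n, (c i).Leaves))

/-- The size `‖T‖` of a tree is its number of leaves. -/
def size (T : RTree) : ℕ := Fintype.card T.Leaves

/-- The part of a set of leaves of `node n c` that lies in the branch `c i`. -/
def branchPart {n : ℕ} {c : Fin n → RTree} (S : Finset (node n c).Leaves) (i : Fin n) :
    Finset (c i).Leaves :=
  Finset.univ.filter fun l => (show (node n c).Leaves from ⟨i, l⟩) ∈ S

/-- The branches of `node n c` that contain an element of `S`. -/
def usedBranches {n : ℕ} {c : Fin n → RTree} (S : Finset (node n c).Leaves) : Finset (Fin n) :=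
  Finset.univ.filter fun i => (branchPart S i).Nonempty

/-- The union of the paths from the root of `T` to the leaves in `S` (for nonempty `S`): only the
vertices with a descendant in `S` are kept. -/
def prune : (T : RTree) → Finset T.Leaves → RTree
  | leaf, _ => leaf
  | node _ c, S => node (usedBranches S).card fun j =>
      prune (c ((usedBranches S).orderEmbOfFin rfl j))
        (branchPart S ((usedBranches S).orderEmbOfFin rfl j))

/-- Suppress all vertices with exactly one child (at the root, the root is replaced by its only
child). -/
def suppress : RTree → RTree
  | leaf => leaf
  | node n c =>
    if h : n = 1 then suppress (c ⟨0, by omega⟩) else node n fun i => suppress (c i)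

/-- The subtree of `T` induced by a nonempty set `S` of leaves. The path from the root of `T` to the
most recent common ancestor of `S`, which `prune` keeps, consists of vertices with one child and is
removed by `suppress`. -/
def leafInduced (T : RTree) (S : Finset T.Leaves) : RTree := suppress (prune T S)

open Classical in
/-- `c(D, T)`: the number of sets of `‖D‖` leaves of `T` that induce a tree isomorphic to `D`. -/
noncomputable def copies (D T : RTree) : ℕ :=
  ((Finset.univ : Finset (Finset T.Leaves)).filter fun S =>
    S.card = D.size ∧ Iso (leafInduced T S) D).card

/-- The density `γ(D, T) = c(D, T) / binom(‖T‖, ‖D‖)`. It lies in `[0, 1]`, and is `0` when `T` has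
fewer leaves than `D`. -/
noncomputable def density (D T : RTree) : ℝ := (copies D T : ℝ) / (T.size.choose D.size : ℝ)

/-- The maximum of `γ(D, T)` over all `d`-ary trees `T` with `n` leaves. (For fixed `D` and `n` the
density takes only finitely many values, so for `n ≥ 1` and `d ≥ 2` the supremum is attained.) -/
noncomputable def maxDensity (d : ℕ) (D : RTree) (n : ℕ) : ℝ :=
  sSup {x : ℝ | ∃ T : RTree, T.IsDary d ∧ T.size = n ∧ density D T = x}

/-- The `d`-ary inducibility `I_d(D)`: the limit superior, as `n` tends to infinity, of the maximum
density of `D` in `d`-ary trees with `n` leaves. -/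
noncomputable def inducibility (d : ℕ) (D : RTree) : ℝ :=
  Filter.limsup (fun n : ℕ => maxDensity d D n) Filter.atTop

theorem div_succ_lt {d k : ℕ} (hd : 2 ≤ d) (hk : d < k) : k / d + 1 < k := by
  have h1 : d * (k / d) ≤ k := Nat.mul_div_le k d
  have h2 : 1 ≤ k / d := (Nat.one_le_div_iff (by omega)).2 hk.le
  rcases h2.eq_or_lt with h | h
  · omega
  · nlinarith

/-- The even `d`-ary tree `E_k^d` with `k` leaves, for `d ≥ 2` and `k ≥ 1`. For `k = 1` it is a
single vertex, for `2 ≤ k ≤ d` it is a star, and for `k > d`, `k = ds + b` with `0 ≤ b < d`, the root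
has `d - b` branches `E_s^d` and `b` branches `E_{s+1}^d`. (Outside the range `d ≥ 2`, `k ≥ 1` the
value is a dummy.) -/
def even (d k : ℕ) : RTree :=
  if _h0 : d < 2 ∨ k < 2 then leaf
  else if _h1 : k ≤ d then node k fun _ => leaf
  else node d fun i => if (i : ℕ) < d - k % d then even d (k / d) else even d (k / d + 1)
termination_by k
decreasing_by
  · exact Nat.div_lt_self (by omega) (by omega)
  · exact div_succ_lt (by omega) (by omega)

end RTree

/-- The constants `c_k` (for fixed `d ≥ 2`): `c_0 = c_1 = 1`, and for `k ≥ 2`, writing `k = ds + b`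
with `0 ≤ b < d`, `c_k = binom(d, b) c_s^(d-b) c_{s+1}^b / (d^k - d)`. The factor `c_{s+1}^b` is
written as `1` when `b = 0`, because `s + 1 = k` is possible then; see `evenConst_rec`. -/
noncomputable def evenConst (d k : ℕ) : ℝ :=
  if _h0 : d < 2 ∨ k < 2 then 1
  else (d.choose (k % d) : ℝ) *
    (evenConst d (k / d) ^ (d - k % d) *
      (if _hb : k % d = 0 then 1 else evenConst d (k / d + 1) ^ (k % d))) /
    ((d : ℝ) ^ k - d)
termination_by k
decreasing_by
  · exact Nat.div_lt_self (by omega) (by omega)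
  · rcases lt_trichotomy d k with h | h | h
    · exact RTree.div_succ_lt (by omega) h
    · subst h; simp at _hb
    · rw [Nat.div_eq_of_lt h]; omega

theorem evenConst_zero (d : ℕ) : evenConst d 0 = 1 := by rw [evenConst]; simp

theorem evenConst_one (d : ℕ) : evenConst d 1 = 1 := by rw [evenConst]; simp

/-- The recursion that defines the constants `c_k`. -/
theorem evenConst_rec (d s b : ℕ) (hd : 2 ≤ d) (hb : b < d) (hk : 2 ≤ d * s + b) :
    evenConst d (d * s + b) =
      (d.choose b : ℝ) * (evenConst d s ^ (d - b) * evenConst d (s + 1) ^ b) /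
        ((d : ℝ) ^ (d * s + b) - d) := by
  have h1 : (d * s + b) % d = b := by rw [Nat.mul_add_mod, Nat.mod_eq_of_lt hb]
  have h2 : (d * s + b) / d = s := by
    rw [Nat.mul_add_div (by omega), Nat.div_eq_of_lt hb, add_zero]
  rw [evenConst, h1, h2, dif_neg (by omega)]
  by_cases hb0 : b = 0
  · subst hb0; simp
  · simp [hb0]

/-!
Why the theorem holds. Write `k = d * s + b` with `b < d`, and let `N_k(T)` be the number of
`k`-sets of leaves of `T` that induce the even tree with `k` leaves (`RTree.evenSets`, with
`N_0 = 1`). Such a set either lies inside one branch of `T` or splits at the root, and in the second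
case it has `s + 1` leaves in `b` of the branches and `s` leaves in the other `d - b`, and is even in
each of them, where missing branches count as branches without leaves. This is the exact recursion
`RTree.card_evenSets_node`:

  `N_k(T) = ∑ i, N_k(T_i) + ∑_{|B| = b} (∏_{i ∈ B} N_{s+1}(T_i)) * (∏_{i ∉ B} N_s(T_i))`.

Upper bound. By induction `N_k(T) ≤ c_k ‖T‖ ^ k`, without any error term
(`RTree.card_evenSets_le`). With `x_i = ‖T_i‖` the induction step is the inequality
`balanced_mean_le`: expand `(∑ x_i) ^ k - ∑ x_i ^ k` into `d ^ k - d` monomials; by Muirhead's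
inequality, each of them has, after symmetrization, at least the mean of the most balanced monomials
of degree `k`, which are the `∏_{i ∈ B} x_i ^ (s + 1) * ∏_{i ∉ B} x_i ^ s`. The recursion of the
constants `c_k` is exactly what makes this fit. The needed case of Muirhead's inequality is proved by
smoothing the exponents (`permSum_smooth_le`).

Lower bound. For the complete tree of height `h`, which has `d ^ h` leaves, the recursion says that
`N_k / d ^ (h * k)` satisfies a linear recursion in `h` with contraction factor `d ^ (1 - k)` and an
inhomogeneous term that converges by induction on `k`; its limit is the fixed point `c_k`
(`tendsto_card_evenSets_complete`).

Since `n ^ k / n.choose k` tends to `k!`, both bounds give `k! * c_k` for the limit superior of the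
densities.
-/

namespace RTree

/-! ### Sizes and induced subtrees -/

theorem size_leaf : leaf.size = 1 := rfl

theorem size_node {n : ℕ} (c : Fin n → RTree) : (node n c).size = ∑ i, (c i).size :=
  Fintype.card_sigma

theorem Iso.size_eq {T U : RTree} (h : Iso T U) : T.size = U.size := by
  induction h with
  | leaf => rfl
  | node e _ ih =>
    rw [size_node, size_node]
    exact Fintype.sum_equiv e _ _ ih

theorem size_suppress (T : RTree) : (suppress T).size = T.size := by
  induction T with
  | leaf => rw [suppress]
  | node n c ih =>
    rw [suppress]
    split_ifs with h
    · subst h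
      rw [ih, size_node, Fin.sum_univ_one]
      rfl
    · rw [size_node, size_node]
      exact Finset.sum_congr rfl fun i _ => ih i

theorem mem_branchPart {n : ℕ} {c : Fin n → RTree} {S : Finset (node n c).Leaves} {i : Fin n}
    {l : (c i).Leaves} :
    l ∈ branchPart S i ↔ (show (node n c).Leaves from ⟨i, l⟩) ∈ S := by
  simp [branchPart]

theorem mem_usedBranches {n : ℕ} {c : Fin n → RTree} {S : Finset (node n c).Leaves} {i : Fin n} :
    i ∈ usedBranches S ↔ (branchPart S i).Nonempty := by
  simp [usedBranches]

/-- A set of leaves of `node n c` is the same as a family of sets of leaves of the branches. -/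
def branchEquiv {n : ℕ} (c : Fin n → RTree) :
    Finset (node n c).Leaves ≃ ((i : Fin n) → Finset (c i).Leaves) where
  toFun S i := branchPart S i
  invFun t := (Finset.univ : Finset (Fin n)).sigma t
  left_inv S := by
    ext ⟨i, l⟩
    exact Finset.mem_sigma.trans ((and_iff_right (Finset.mem_univ i)).trans mem_branchPart)
  right_inv t := by
    funext i
    ext l
    exact mem_branchPart.trans (Finset.mem_sigma.trans (and_iff_right (Finset.mem_univ i)))

theorem card_eq_sum_branchPart {n : ℕ} {c : Fin n → RTree} (S : Finset (node n c).Leaves) :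
    S.card = ∑ i, (branchPart S i).card := by
  conv_lhs => rw [← (branchEquiv c).symm_apply_apply S]
  exact Finset.card_sigma _ _

/-- Nonemptiness matters: the leaf is its own pruning, even for the empty set. -/
theorem size_prune (T : RTree) (S : Finset T.Leaves) (hS : S.Nonempty) :
    (prune T S).size = S.card := by
  induction T with
  | leaf =>
    have h : S.card ≤ 1 := Finset.card_le_univ S
    have := hS.card_pos
    rw [prune, size_leaf]
    omega
  | node n c ih =>
    rw [prune, size_node, card_eq_sum_branchPart S,
      ← Finset.sum_subset (Finset.subset_univ (usedBranches S))]
    · trans ∑ i ∈ Finset.univ.map ((usedBranches S).orderEmbOfFin rfl).toEmbedding,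
        (branchPart S i).card
      · rw [Finset.sum_map]
        refine Finset.sum_congr rfl fun j _ => ih _ _ ?_
        exact mem_usedBranches.1 (Finset.orderEmbOfFin_mem _ rfl j)
      · rw [Finset.map_orderEmbOfFin_univ]
    · intro i _ hi
      rwa [mem_usedBranches, Finset.not_nonempty_iff_eq_empty, ← Finset.card_eq_zero] at hi

theorem size_leafInduced (T : RTree) {S : Finset T.Leaves} (hS : S.Nonempty) :
    (leafInduced T S).size = S.card := by
  rw [leafInduced, size_suppress, size_prune T S hS]

theorem leafInduced_node_of_usedBranches_eq_singleton {n : ℕ} {c : Fin n → RTree}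
    {S : Finset (node n c).Leaves} {i : Fin n} (h : usedBranches S = {i}) :
    leafInduced (node n c) S = leafInduced (c i) (branchPart S i) := by
  have hc : (usedBranches S).card = 1 := by rw [h, Finset.card_singleton]
  have key : ∀ j, j ∈ usedBranches S →
      suppress (prune (c j) (branchPart S j)) = leafInduced (c i) (branchPart S i) := by
    intro j hj
    rw [h, Finset.mem_singleton] at hj
    subst hj
    rfl
  rw [leafInduced, prune, suppress, dif_pos hc]
  exact key _ (Finset.orderEmbOfFin_mem _ rfl _)

theorem leafInduced_node_of_card_usedBranches_ne_one {n : ℕ} {c : Fin n → RTree}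
    {S : Finset (node n c).Leaves} (h : (usedBranches S).card ≠ 1) :
    leafInduced (node n c) S = node (usedBranches S).card fun j =>
      leafInduced (c ((usedBranches S).orderEmbOfFin rfl j))
        (branchPart S ((usedBranches S).orderEmbOfFin rfl j)) := by
  rw [leafInduced, prune, suppress, dif_neg h]
  rfl

/-! ### Branches of even trees -/

/-- The exponents `s + 1` on `B` and `s` off `B`. With `B.card = b`, these are the numbers of leaves
of the `d` branches of the even tree with `d * s + b` leaves, where for `s = 0` a zero stands for an
absent branch. -/
def balancedPart {d : ℕ} (s : ℕ) (B : Finset (Fin d)) (i : Fin d) : ℕ :=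
  if i ∈ B then s + 1 else s

theorem prod_balancedPart {d s b : ℕ} {B : Finset (Fin d)} (hB : B.card = b) {M : Type*}
    [CommMonoid M] (f : ℕ → M) :
    ∏ i, f (balancedPart s B i) = f s ^ (d - b) * f (s + 1) ^ b := by
  have h : ∀ i, f (balancedPart s B i) = if i ∈ B then f (s + 1) else f s := fun i => by
    rw [balancedPart]
    split_ifs <;> rfl
  have h2 : (Finset.univ.filter fun i => i ∉ B).card = d - b := by
    rw [Finset.filter_not, Finset.filter_mem_eq_inter, Finset.univ_inter,
      Finset.card_sdiff_of_subset (Finset.subset_univ B), hB, Finset.card_univ, Fintype.card_fin]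
  simp_rw [h]
  rw [Finset.prod_ite, Finset.prod_const, Finset.prod_const, h2, Finset.filter_mem_eq_inter,
    Finset.univ_inter, hB, mul_comm]

theorem sum_balancedPart {d : ℕ} (s : ℕ) (B : Finset (Fin d)) :
    ∑ i, balancedPart s B i = d * s + B.card := by
  have h : ∀ i, balancedPart s B i = s + if i ∈ B then 1 else 0 := fun i => by
    rw [balancedPart]
    split_ifs <;> rfl
  simp [h, Finset.sum_add_distrib]

theorem even_one (d : ℕ) : even d 1 = leaf := by rw [even]; simp

theorem even_of_lt {d k : ℕ} (hk : 2 ≤ k) (hkd : k < d) : even d k = node k fun _ => leaf := by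
  rw [even, dif_neg (by omega), dif_pos hkd.le]

theorem even_of_le {d k : ℕ} (hd : 2 ≤ d) (hkd : d ≤ k) :
    even d k = node d fun i =>
      if (i : ℕ) < d - k % d then even d (k / d) else even d (k / d + 1) := by
  rcases hkd.eq_or_lt with rfl | h
  · rw [even, dif_neg (by omega), dif_pos le_rfl]
    simp [Nat.div_self (by omega : 0 < d), even_one]
  · rw [even, dif_neg (by omega), dif_neg (by omega)]

/-- The last `b` indices, which carry the larger branches in `RTree.even`. -/
theorem card_filter_sub_le {d b : ℕ} (hb : b ≤ d) :
    (Finset.univ.filter fun i : Fin d => d - b ≤ (i : ℕ)).card = b := by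
  have h := Fin.card_filter_val_lt (n := d) (m := d - b)
  have h2 := Finset.card_filter_add_card_filter_not (s := (Finset.univ : Finset (Fin d)))
    (fun i : Fin d => (i : ℕ) < d - b)
  simp only [not_lt, Finset.card_univ, Fintype.card_fin] at h2
  omega

theorem size_even {d k : ℕ} (hd : 2 ≤ d) (hk : 1 ≤ k) : (even d k).size = k := by
  induction k using Nat.strong_induction_on with
  | _ k ih =>
    rcases hk.eq_or_lt with rfl | hk
    · rw [even_one, size_leaf]
    rcases lt_or_ge k d with hkd | hkd
    · rw [even_of_lt hk hkd, size_node]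
      simp [size_leaf]
    · have h1 : 1 ≤ k / d := (Nat.one_le_div_iff (by omega)).2 hkd
      have hb : k % d < d := Nat.mod_lt _ (by omega)
      rw [even_of_le hd hkd, size_node]
      set B := Finset.univ.filter fun i : Fin d => d - k % d ≤ (i : ℕ) with hB
      have key : ∀ i : Fin d, (if (i : ℕ) < d - k % d then even d (k / d)
          else even d (k / d + 1)).size = balancedPart (k / d) B i := by
        intro i
        rw [balancedPart]
        split_ifs with h2 h3 h3
        · simp [hB] at h3; omega
        · exact ih _ (Nat.div_lt_self (by omega) (by omega)) h1
        · refine ih _ ?_ (by omega)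
          rcases hkd.eq_or_lt with rfl | h
          · simp at h2
          · exact div_succ_lt hd h
        · simp [hB] at h3; omega
      rw [Finset.sum_congr rfl fun i _ => key i, sum_balancedPart, card_filter_sub_le hb.le,
        Nat.div_add_mod]

theorem exists_perm_mem_iff {d : ℕ} {B C : Finset (Fin d)} (h : B.card = C.card) :
    ∃ σ : Equiv.Perm (Fin d), ∀ i, σ i ∈ C ↔ i ∈ B := by
  have e : {i // i ∈ B} ≃ {i // i ∈ C} := Fintype.equivOfCardEq (by simpa using h)
  refine ⟨e.extendSubtype, fun i => ⟨fun hi => ?_, fun hi => e.extendSubtype_mem i hi⟩⟩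
  by_contra hn
  exact e.extendSubtype_not_mem i hn hi

/-- A tree with `m ≤ d` branches, placed by `φ` among `d` possible positions, is isomorphic to the
even tree with `d * s + b` leaves iff `b` of the positions can be chosen such that the branches at
these positions are even with `s + 1` leaves and those at the other positions are even with `s`
leaves, a position being unoccupied iff it should carry `0` leaves. -/
theorem iso_even_iff {d s b m : ℕ} (hd : 2 ≤ d) (hb : b < d) (hk : 2 ≤ d * s + b)
    (φ : Fin m ↪ Fin d) (X : Fin m → RTree) :
    Iso (node m X) (even d (d * s + b)) ↔ ∃ B : Finset (Fin d), B.card = b ∧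
      (∀ j, balancedPart s B (φ j) ≠ 0 ∧ Iso (X j) (even d (balancedPart s B (φ j)))) ∧
      ∀ i, i ∉ Set.range φ → balancedPart s B i = 0 := by
  -- For `s = 0` the even tree is a star with `b < d` leaves; otherwise it has `d` branches, and then
  -- `φ` is a bijection in both directions of the equivalence.
  rcases Nat.eq_zero_or_pos s with rfl | hs
  · rw [mul_zero, zero_add] at hk ⊢
    rw [even_of_lt hk hb]
    constructor
    · intro h
      cases h with
      | node e h =>
        have hm : m = b := by simpa using Fintype.card_congr e
        refine ⟨Finset.univ.map φ, by simp [hm], fun j => ?_, fun i hi => ?_⟩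
        · have : balancedPart 0 (Finset.univ.map φ) (φ j) = 1 := by simp [balancedPart]
          rw [this, even_one]
          exact ⟨one_ne_zero, h j⟩
        · have : ∀ j, φ j ≠ i := fun j hj => hi ⟨j, hj⟩
          simp [balancedPart, this]
    · rintro ⟨B, hB, h1, h2⟩
      have hmem : ∀ j, φ j ∈ B := fun j => by
        by_contra hj
        exact (h1 j).1 (by simp [balancedPart, hj])
      have hBm : B = Finset.univ.map φ := by
        ext i
        constructor
        · intro hi
          by_contra hn
          have := h2 i (by simpa using hn)
          simp [balancedPart, hi] at this
        · intro hi
          obtain ⟨j, -, rfl⟩ := Finset.mem_map.1 hi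
          exact hmem j
      have hm : m = b := by rw [← hB, hBm]; simp
      subst hm
      refine .node (Equiv.refl _) fun j => ?_
      have := (h1 j).2
      rwa [balancedPart, if_pos (hmem j), zero_add, even_one] at this
  · have hkd : d ≤ d * s + b := by nlinarith
    have h1 : (d * s + b) % d = b := by rw [Nat.mul_add_mod, Nat.mod_eq_of_lt hb]
    have h2 : (d * s + b) / d = s := by
      rw [Nat.mul_add_div (by omega), Nat.div_eq_of_lt hb, add_zero]
    rw [even_of_le hd hkd, h1, h2]
    have hne : ∀ B (i : Fin d), balancedPart s B i ≠ 0 := fun B i => by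
      rw [balancedPart]; split_ifs <;> omega
    constructor
    · intro h
      cases h with
      | node e h =>
        have hm : m = d := by simpa using Fintype.card_congr e
        subst hm
        have hφ : Function.Bijective φ :=
          (Fintype.bijective_iff_injective_and_card φ).2 ⟨φ.injective, rfl⟩
        refine ⟨(Finset.univ.filter fun i : Fin m => m - b ≤ (i : ℕ)).map
          (e.symm.toEmbedding.trans φ), ?_, fun j => ⟨hne _ _, ?_⟩, fun i hi => ?_⟩
        · rw [Finset.card_map, card_filter_sub_le hb.le]
        · have hlt := (e j).2
          have hmem : φ j ∈ (Finset.univ.filter fun i : Fin m => m - b ≤ (i : ℕ)).map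
              (e.symm.toEmbedding.trans φ) ↔ m - b ≤ (e j : ℕ) := by
            simp [Equiv.symm_apply_eq]
          have := h j
          simp only at this
          simp only [balancedPart, hmem]
          by_cases h3 : (e j : ℕ) < m - b
          · have h4 : ¬ m - b ≤ (e j : ℕ) := by omega
            rw [if_pos h3] at this
            rwa [if_neg h4]
          · have h4 : m - b ≤ (e j : ℕ) := by omega
            rw [if_neg h3] at this
            rwa [if_pos h4]
        · exact absurd (hφ.2 i) hi
    · rintro ⟨B, hB, h3, h4⟩
      have hφ : Function.Bijective φ := by
        refine ⟨φ.injective, fun i => ?_⟩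
        by_contra hi
        exact hne B i (h4 i hi)
      obtain ⟨σ, hσ⟩ := exists_perm_mem_iff (hB.trans (card_filter_sub_le hb.le).symm)
      refine .node ((Equiv.ofBijective φ hφ).trans σ) fun j => ?_
      have h5 := hσ (φ j)
      have h6 := (h3 j).2
      simp only [Finset.mem_filter, Finset.mem_univ, true_and] at h5
      simp only [Equiv.trans_apply, Equiv.ofBijective_apply]
      rw [balancedPart] at h6
      by_cases h7 : φ j ∈ B
      · rw [if_pos h7] at h6
        rwa [if_neg (by have := h5.2 h7; omega)]
      · rw [if_neg h7] at h6
        rwa [if_pos (by by_contra h8; exact h7 (h5.1 (by omega)))]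

end RTree

/-! ### A Muirhead inequality -/

/-- The sum over all permutations of the monomial in `x` with exponents `a`: up to the factor `d!`
this is the symmetric mean of type `a`. -/
noncomputable def permSum {d : ℕ} (x : Fin d → ℝ) (a : Fin d → ℕ) : ℝ :=
  ∑ σ : Equiv.Perm (Fin d), ∏ i, x (σ i) ^ a i

theorem permSum_comp_perm {d : ℕ} (x : Fin d → ℝ) (a : Fin d → ℕ) (τ : Equiv.Perm (Fin d)) :
    permSum x (fun i => a (τ i)) = permSum x a := by
  rw [permSum, permSum]
  refine Fintype.sum_equiv (Equiv.mulRight τ⁻¹) _ _ fun σ => ?_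
  refine Fintype.prod_equiv τ _ _ fun i => ?_
  simp

theorem pow_mul_pow_add_le {x y : ℝ} (hx : 0 ≤ x) (hy : 0 ≤ y) {p q : ℕ} (h : q ≤ p) :
    x ^ p * y ^ (q + 1) + x ^ (q + 1) * y ^ p ≤ x ^ (p + 1) * y ^ q + x ^ q * y ^ (p + 1) := by
  obtain ⟨r, rfl⟩ := Nat.exists_eq_add_of_le h
  have h1 : 0 ≤ (x ^ r - y ^ r) * (x - y) := by
    rcases le_total x y with hxy | hxy
    · exact mul_nonneg_of_nonpos_of_nonpos (sub_nonpos.2 (pow_le_pow_left₀ hx hxy r))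
        (sub_nonpos.2 hxy)
    · exact mul_nonneg (sub_nonneg.2 (pow_le_pow_left₀ hy hxy r)) (sub_nonneg.2 hxy)
  have h2 : 0 ≤ (x * y) ^ q * ((x ^ r - y ^ r) * (x - y)) := by positivity
  rw [mul_pow] at h2
  rw [← sub_nonneg]
  convert h2 using 1
  ring

/-- The smoothing step: moving one unit from a larger exponent to a smaller one does not increase
the symmetric mean. -/
theorem permSum_smooth_le {d : ℕ} {x : Fin d → ℝ} (hx : ∀ i, 0 ≤ x i) {a a' : Fin d → ℕ}
    {i j : Fin d} (hij : i ≠ j) {p q : ℕ} (hqp : q ≤ p) (hai : a i = p + 1) (haj : a j = q)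
    (hai' : a' i = p) (haj' : a' j = q + 1) (h : ∀ l, l ≠ i → l ≠ j → a' l = a l) :
    permSum x a' ≤ permSum x a := by
  -- Pair each permutation with its composition with the transposition of `i` and `j`.
  have hdouble : ∀ a : Fin d → ℕ, 2 * permSum x a = ∑ σ : Equiv.Perm (Fin d),
      (x (σ i) ^ a i * x (σ j) ^ a j + x (σ i) ^ a j * x (σ j) ^ a i) *
        ∏ l ∈ ((Finset.univ.erase i).erase j), x (σ l) ^ a l := by
    intro a
    have hsplit : ∀ b : Fin d → ℕ, permSum x b = ∑ σ : Equiv.Perm (Fin d),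
        x (σ i) ^ b i * x (σ j) ^ b j * ∏ l ∈ ((Finset.univ.erase i).erase j), x (σ l) ^ b l := by
      intro b
      rw [permSum]
      refine Finset.sum_congr rfl fun σ _ => ?_
      rw [mul_assoc, Finset.mul_prod_erase _ (fun l => x (σ l) ^ b l) (by simp [hij.symm]),
        Finset.mul_prod_erase _ (fun l => x (σ l) ^ b l) (by simp)]
    rw [two_mul]
    conv_lhs => arg 2; rw [← permSum_comp_perm x a (Equiv.swap i j)]
    rw [hsplit, hsplit, ← Finset.sum_add_distrib]
    refine Finset.sum_congr rfl fun σ _ => ?_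
    have : ∏ l ∈ ((Finset.univ.erase i).erase j), x (σ l) ^ a (Equiv.swap i j l) =
        ∏ l ∈ ((Finset.univ.erase i).erase j), x (σ l) ^ a l := by
      refine Finset.prod_congr rfl fun l hl => ?_
      simp only [Finset.mem_erase, Finset.mem_univ, and_true] at hl
      rw [Equiv.swap_apply_of_ne_of_ne hl.2 hl.1]
    rw [this, Equiv.swap_apply_left, Equiv.swap_apply_right]
    ring
  have h2 : 2 * permSum x a' ≤ 2 * permSum x a := by
    rw [hdouble, hdouble]
    refine Finset.sum_le_sum fun σ _ => ?_
    have : ∏ l ∈ ((Finset.univ.erase i).erase j), x (σ l) ^ a' l =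
        ∏ l ∈ ((Finset.univ.erase i).erase j), x (σ l) ^ a l := by
      refine Finset.prod_congr rfl fun l hl => ?_
      simp only [Finset.mem_erase, Finset.mem_univ, and_true] at hl
      rw [h l hl.2 hl.1]
    rw [this, hai, haj, hai', haj']
    exact mul_le_mul_of_nonneg_right (pow_mul_pow_add_le (hx _) (hx _) hqp)
      (Finset.prod_nonneg fun l _ => pow_nonneg (hx _) _)
  linarith

open RTree in
/-- Exponents that differ pairwise by at most one are balanced. -/
theorem exists_eq_balancedPart {d s b : ℕ} (hb : b < d) {a : Fin d → ℕ}
    (ha : ∑ i, a i = d * s + b) (h : ∀ i j, a i ≤ a j + 1) :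
    ∃ B : Finset (Fin d), B.card = b ∧ a = balancedPart s B := by
  have hle : ∀ i, a i ≤ s + 1 := by
    intro i
    by_contra hi
    have : ∑ _j : Fin d, (s + 1) ≤ ∑ j, a j :=
      Finset.sum_le_sum fun j _ => by have := h i j; omega
    rw [ha] at this
    simp at this
    nlinarith
  have hge : ∀ i, s ≤ a i := by
    intro i
    by_contra hi
    have : ∑ j, a j < ∑ _j : Fin d, s :=
      Finset.sum_lt_sum (fun j _ => by have := h j i; omega) ⟨i, Finset.mem_univ i, by omega⟩
    rw [ha] at this
    simp at this
  have hB : a = balancedPart s (Finset.univ.filter fun i => a i = s + 1) := by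
    funext i
    have h1 := hle i
    have h2 := hge i
    simp only [balancedPart, Finset.mem_filter, Finset.mem_univ, true_and]
    split_ifs <;> omega
  refine ⟨_, ?_, hB⟩
  have := sum_balancedPart s (Finset.univ.filter fun i => a i = s + 1)
  rw [← hB, ha] at this
  omega

open RTree in
theorem permSum_balancedPart_le {d s b : ℕ} (hb : b < d) {x : Fin d → ℝ} (hx : ∀ i, 0 ≤ x i)
    {B : Finset (Fin d)} (hB : B.card = b) (a : Fin d → ℕ) (ha : ∑ i, a i = d * s + b) :
    permSum x (balancedPart s B) ≤ permSum x a := by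
  -- Smoothing decreases the sum of the squares of the exponents.
  induction hN : ∑ i, a i ^ 2 using Nat.strong_induction_on generalizing a with
  | _ N ih =>
    by_cases h : ∀ i j, a i ≤ a j + 1
    · obtain ⟨C, hC, rfl⟩ := exists_eq_balancedPart hb ha h
      obtain ⟨σ, hσ⟩ := exists_perm_mem_iff (hB.trans hC.symm)
      rw [← permSum_comp_perm x (balancedPart s C) σ]
      refine le_of_eq (congrArg _ (funext fun i => ?_))
      simp only [balancedPart, hσ]
    · push Not at h
      obtain ⟨i, j, hij⟩ := h
      have hne : i ≠ j := by rintro rfl; omega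
      obtain ⟨p, hp⟩ : ∃ p, a i = p + 1 := ⟨a i - 1, by omega⟩
      set a' : Fin d → ℕ := Function.update (Function.update a i p) j (a j + 1) with ha'
      have hi' : a' i = p := by simp [ha', hne]
      have hj' : a' j = a j + 1 := by simp [ha']
      have hl' : ∀ l, l ≠ i → l ≠ j → a' l = a l := fun l h1 h2 => by simp [ha', h1, h2]
      have hsum : ∀ f : ℕ → ℕ, ∑ l, f (a' l) + (f (p + 1) + f (a j)) =
          ∑ l, f (a l) + (f p + f (a j + 1)) := by
        intro f
        have hsp : ∀ c : Fin d → ℕ, ∑ l, f (c l) =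
            f (c i) + (f (c j) + ∑ l ∈ ((Finset.univ.erase i).erase j), f (c l)) := fun c => by
          rw [Finset.add_sum_erase _ (fun l => f (c l)) (by simp [hne.symm]),
            Finset.add_sum_erase _ (fun l => f (c l)) (by simp)]
        have : ∑ l ∈ ((Finset.univ.erase i).erase j), f (a' l) =
            ∑ l ∈ ((Finset.univ.erase i).erase j), f (a l) :=
          Finset.sum_congr rfl fun l hl => by
            simp only [Finset.mem_erase, Finset.mem_univ, and_true] at hl
            rw [hl' l hl.2 hl.1]
        rw [hsp a', hsp a, this, hi', hj', hp]
        ring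
      refine (ih _ ?_ a' ?_ rfl).trans
        (permSum_smooth_le hx hne (by omega : a j ≤ p) hp rfl hi' hj' hl')
      · have := hsum fun t => t ^ 2
        nlinarith
      · have := hsum id
        simp only [id] at this
        omega

open RTree in
/-- Averaging over the sets `B`: all balanced exponent vectors have the same symmetric mean. -/
theorem choose_mul_permSum_balancedPart {d s b : ℕ} (x : Fin d → ℝ) {B : Finset (Fin d)}
    (hB : B.card = b) :
    (d.choose b : ℝ) * permSum x (balancedPart s B) =
      d.factorial * ∑ C ∈ Finset.powersetCard b Finset.univ, ∏ i, x i ^ balancedPart s C i := by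
  have h1 : ∑ C ∈ Finset.powersetCard b (Finset.univ : Finset (Fin d)),
      permSum x (balancedPart s C) = d.choose b * permSum x (balancedPart s B) := by
    have : ∀ C ∈ Finset.powersetCard b (Finset.univ : Finset (Fin d)),
        permSum x (balancedPart s C) = permSum x (balancedPart s B) := by
      intro C hC
      obtain ⟨σ, hσ⟩ := exists_perm_mem_iff (hB.trans (Finset.mem_powersetCard.1 hC).2.symm)
      rw [← permSum_comp_perm x (balancedPart s C) σ]
      refine congrArg _ (funext fun i => ?_)
      simp only [balancedPart, hσ]
    rw [Finset.sum_congr rfl this]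
    simp [Finset.card_powersetCard]
  rw [← h1]
  simp only [permSum]
  rw [Finset.sum_comm]
  have h2 : ∀ σ : Equiv.Perm (Fin d), ∑ C ∈ Finset.powersetCard b Finset.univ,
      ∏ i, x (σ i) ^ balancedPart s C i =
      ∑ C ∈ Finset.powersetCard b Finset.univ, ∏ i, x i ^ balancedPart s C i := by
    intro σ
    refine Finset.sum_equiv σ.finsetCongr (fun C => ?_) fun C _ => ?_
    · simp [Finset.mem_powersetCard]
    · refine Fintype.prod_equiv σ _ _ fun i => ?_
      simp [balancedPart]
  rw [Finset.sum_congr rfl fun σ _ => h2 σ]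
  simp [Fintype.card_perm]

theorem exists_finset_card_eq {d b : ℕ} (hb : b < d) : ∃ B : Finset (Fin d), B.card = b := by
  obtain ⟨B, -, hB⟩ := Finset.exists_subset_card_eq
    (s := (Finset.univ : Finset (Fin d))) (n := b) (by simpa using hb.le)
  exact ⟨B, hB⟩

open RTree in
/-- Among the `d ^ k` monomials of `(∑ x i) ^ k`, the `d ^ k - d` that are not pure powers have, after
symmetrization, at least the balanced mean. -/
theorem balanced_mean_le {d s b : ℕ} (hb : b < d) (hk : 1 ≤ d * s + b) {x : Fin d → ℝ}
    (hx : ∀ i, 0 ≤ x i) :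
    ((d : ℝ) ^ (d * s + b) - d) *
        ∑ C ∈ Finset.powersetCard b Finset.univ, ∏ i, x i ^ balancedPart s C i ≤
      d.choose b * ((∑ i, x i) ^ (d * s + b) - ∑ i, x i ^ (d * s + b)) := by
  obtain ⟨B, hB⟩ := exists_finset_card_eq hb
  generalize hkk : d * s + b = k at hk ⊢
  have hexp : ∀ σ : Equiv.Perm (Fin d), ∀ f : Fin k → Fin d,
      ∏ t, x (σ (f t)) = ∏ i, x (σ i) ^ (Finset.univ.filter fun t => f t = i).card := by
    intro σ f
    rw [← Finset.prod_fiberwise Finset.univ f]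
    refine Finset.prod_congr rfl fun i _ => ?_
    rw [Finset.prod_congr rfl (g := fun _ => x (σ i)) fun t ht => by
      rw [(Finset.mem_filter.1 ht).2], Finset.prod_const]
  -- The constant functions, which produce the pure powers.
  set K : Finset (Fin k → Fin d) := Finset.univ.map
    ⟨Function.const (Fin k), fun i j h => congrFun h ⟨0, hk⟩⟩ with hK
  have hKsum : ∀ y : Fin d → ℝ, ∑ f ∈ K, ∏ t, y (f t) = ∑ i, y i ^ k := fun y => by
    rw [hK, Finset.sum_map]
    refine Finset.sum_congr rfl fun i _ => (Finset.prod_const (y i)).trans ?_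
    rw [Finset.card_univ, Fintype.card_fin]
  have hdiff : ∀ σ : Equiv.Perm (Fin d), ∑ f ∈ Kᶜ, ∏ t, x (σ (f t)) =
      (∑ i, x i) ^ k - ∑ i, x i ^ k := by
    intro σ
    have h1 := hKsum fun i => x (σ i)
    have h2 : (∑ i, x (σ i)) ^ k = ∑ f : Fin k → Fin d, ∏ t, x (σ (f t)) :=
      Fintype.sum_pow (fun i => x (σ i)) k
    rw [← Finset.sum_add_sum_compl K, h1, Equiv.sum_comp σ x,
      Equiv.sum_comp σ fun i => x i ^ k] at h2
    linarith
  have hcard : (Kᶜ.card : ℝ) = (d : ℝ) ^ k - d := by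
    have h1 := Finset.card_add_card_compl K
    rw [hK, Finset.card_map, ← hK] at h1
    simp only [Finset.card_univ, Fintype.card_fin, Fintype.card_fun] at h1
    rw [eq_sub_iff_add_eq']
    exact_mod_cast h1
  have hmain : (Kᶜ.card : ℝ) * permSum x (balancedPart s B) ≤
      d.factorial * ((∑ i, x i) ^ k - ∑ i, x i ^ k) := by
    have h1 : (d.factorial : ℝ) * ((∑ i, x i) ^ k - ∑ i, x i ^ k) =
        ∑ σ : Equiv.Perm (Fin d), ∑ f ∈ Kᶜ, ∏ t, x (σ (f t)) := by
      rw [Finset.sum_congr rfl fun σ _ => hdiff σ, Finset.sum_const, Finset.card_univ,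
        Fintype.card_perm, Fintype.card_fin, nsmul_eq_mul]
    rw [h1, Finset.sum_comm, ← nsmul_eq_mul]
    refine Finset.card_nsmul_le_sum _ _ _ fun f _ => ?_
    simp_rw [hexp]
    refine permSum_balancedPart_le hb hx hB _ ?_
    rw [hkk, ← Finset.card_eq_sum_card_fiberwise (fun _ _ => Finset.mem_coe.2 (Finset.mem_univ _))]
    simp
  have hav := choose_mul_permSum_balancedPart (s := s) x hB
  rw [hcard] at hmain
  have hpos : (0 : ℝ) < d.factorial := by exact_mod_cast d.factorial_pos
  have hch : (0 : ℝ) ≤ d.choose b := Nat.cast_nonneg _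
  refine le_of_mul_le_mul_left ?_ hpos
  calc _ = ((d : ℝ) ^ k - d) * (d.factorial *
        ∑ C ∈ Finset.powersetCard b Finset.univ, ∏ i, x i ^ balancedPart s C i) := by ring
    _ = d.choose b * (((d : ℝ) ^ k - d) * permSum x (balancedPart s B)) := by rw [← hav]; ring
    _ ≤ d.choose b * (d.factorial * ((∑ i, x i) ^ k - ∑ i, x i ^ k)) :=
        mul_le_mul_of_nonneg_left hmain hch
    _ = _ := by ring

namespace RTree

/-! ### Counting even subtrees -/

open Classical in
/-- The sets of `k` leaves of `T` that induce the even tree with `k` leaves. The empty set is taken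
to induce the empty tree, so that for `k = 0` there is one such set. -/
noncomputable def evenSets (d : ℕ) (T : RTree) (k : ℕ) : Finset (Finset T.Leaves) :=
  Finset.univ.filter fun S =>
    S.card = k ∧ (S.Nonempty → Iso (leafInduced T S) (even d k))

theorem mem_evenSets {d : ℕ} {T : RTree} {k : ℕ} {S : Finset T.Leaves} :
    S ∈ evenSets d T k ↔ S.card = k ∧ (S.Nonempty → Iso (leafInduced T S) (even d k)) := by
  simp [evenSets]

theorem mem_evenSets_zero {d : ℕ} {T : RTree} {S : Finset T.Leaves} :
    S ∈ evenSets d T 0 ↔ S = ∅ := by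
  rw [mem_evenSets, Finset.card_eq_zero]
  constructor
  · exact And.left
  · rintro rfl
    simp

theorem evenSets_zero (d : ℕ) (T : RTree) : evenSets d T 0 = {∅} := by
  ext S
  rw [mem_evenSets_zero, Finset.mem_singleton]

theorem copies_even {d k : ℕ} (hd : 2 ≤ d) (hk : 1 ≤ k) (T : RTree) :
    copies (even d k) T = (evenSets d T k).card := by
  classical
  rw [copies]
  congr 1
  ext S
  refine Finset.mem_filter.trans ?_
  rw [mem_evenSets, size_even hd hk, and_iff_right (Finset.mem_univ S)]
  refine and_congr_right fun h => (imp_iff_right ?_).symm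
  rw [← Finset.card_pos]
  omega

theorem iso_even_one_of_card_eq_one {d : ℕ} (T : RTree) (S : Finset T.Leaves) (hS : S.card = 1) :
    Iso (leafInduced T S) (even d 1) := by
  rw [even_one]
  induction T with
  | leaf =>
    rw [leafInduced, prune, suppress]
    exact .leaf
  | node n c ih =>
    have hsum := card_eq_sum_branchPart S
    rw [hS] at hsum
    obtain ⟨i, -, hi⟩ : ∃ i ∈ Finset.univ, (branchPart S i).card ≠ 0 := by
      by_contra! h
      rw [Finset.sum_eq_zero h] at hsum
      omega
    have hsp := Finset.add_sum_erase Finset.univ (fun i => (branchPart S i).card)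
      (Finset.mem_univ i)
    have hu : usedBranches S = {i} := by
      ext j
      rw [mem_usedBranches, Finset.mem_singleton, ← Finset.card_pos]
      constructor
      · intro hj
        by_contra hne
        have := Finset.single_le_sum (f := fun i => (branchPart S i).card)
          (fun _ _ => Nat.zero_le _) (Finset.mem_erase.2 ⟨hne, Finset.mem_univ j⟩)
        omega
      · rintro rfl
        omega
    rw [leafInduced_node_of_usedBranches_eq_singleton hu]
    exact ih i _ (by omega)

theorem card_evenSets_one (d : ℕ) (T : RTree) : (evenSets d T 1).card = T.size := by
  have : evenSets d T 1 = Finset.powersetCard 1 Finset.univ := by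
    ext S
    rw [mem_evenSets, Finset.mem_powersetCard, and_iff_right (Finset.subset_univ S)]
    exact and_iff_left_of_imp fun h _ => iso_even_one_of_card_eq_one T S h
  rw [this, Finset.card_powersetCard, Nat.choose_one_right]
  rfl

theorem evenSets_leaf (d : ℕ) {k : ℕ} (hk : 2 ≤ k) : evenSets d leaf k = ∅ := by
  ext S
  have h : S.card ≤ 1 := Finset.card_le_univ S
  rw [mem_evenSets]
  simp only [Finset.notMem_empty, iff_false]
  intro h2
  omega

theorem balancedPart_lt {d s b : ℕ} (hd : 2 ≤ d) (hk : 2 ≤ d * s + b) {B : Finset (Fin d)}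
    (hB : B.card = b) (i : Fin d) : balancedPart s B i < d * s + b := by
  rw [balancedPart]
  split_ifs with h
  · have : 1 ≤ b := hB ▸ Finset.card_pos.2 ⟨i, h⟩
    rcases Nat.eq_zero_or_pos s with rfl | hs
    · omega
    · nlinarith
  · rcases Nat.eq_zero_or_pos s with rfl | hs
    · omega
    · nlinarith

/-- An even set of `k = d * s + b` leaves either lies in one branch, or it splits at the root into
even sets with `s` or `s + 1` leaves. -/
theorem mem_evenSets_node {d s b n : ℕ} (hd : 2 ≤ d) (hb : b < d) (hk : 2 ≤ d * s + b)
    (hn : n ≤ d) (c : Fin n → RTree) (S : Finset (node n c).Leaves) :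
    S ∈ evenSets d (node n c) (d * s + b) ↔
      (∃ i, ∀ j, branchPart S j ∈ evenSets d (c j) (if j = i then d * s + b else 0)) ∨
      ∃ B : Finset (Fin d), (B.card = b ∧ ∀ i : Fin d, n ≤ i → balancedPart s B i = 0) ∧
        ∀ j, branchPart S j ∈ evenSets d (c j) (balancedPart s B (Fin.castLE hn j)) := by
  constructor
  · intro h
    obtain ⟨hcard, hiso⟩ := mem_evenSets.1 h
    have hne : S.Nonempty := by rw [← Finset.card_pos]; omega
    replace hiso := hiso hne
    by_cases hu : (usedBranches S).card = 1
    · obtain ⟨i, hi⟩ := Finset.card_eq_one.1 hu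
      have h0 : ∀ j, j ≠ i → branchPart S j = ∅ := by
        intro j hj
        rw [← Finset.not_nonempty_iff_eq_empty, ← mem_usedBranches, hi]
        simpa using hj
      refine .inl ⟨i, fun j => ?_⟩
      split_ifs with hj
      · subst hj
        rw [leafInduced_node_of_usedBranches_eq_singleton hi] at hiso
        refine mem_evenSets.2 ⟨?_, fun _ => hiso⟩
        rw [card_eq_sum_branchPart, Finset.sum_eq_single j] at hcard
        · exact hcard
        · intro l _ hl
          rw [h0 l hl, Finset.card_empty]
        · simp
      · exact mem_evenSets_zero.2 (h0 j hj)
    · rw [leafInduced_node_of_card_usedBranches_ne_one hu,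
        iso_even_iff hd hb hk
          (((usedBranches S).orderEmbOfFin rfl).toEmbedding.trans (Fin.castLEEmb hn))] at hiso
      obtain ⟨B, hB, h1, h2⟩ := hiso
      refine .inr ⟨B, ⟨hB, fun i hi => h2 i ?_⟩, fun j => ?_⟩
      · rintro ⟨l, rfl⟩
        have := ((usedBranches S).orderEmbOfFin rfl l).2
        simp at hi
        omega
      · by_cases hj : j ∈ usedBranches S
        · obtain ⟨l, rfl⟩ : ∃ l, (usedBranches S).orderEmbOfFin rfl l = j := by
            have : j ∈ Set.range ((usedBranches S).orderEmbOfFin rfl) := by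
              rw [Finset.range_orderEmbOfFin]
              exact hj
            exact this
          obtain ⟨h3, h4⟩ := h1 l
          refine mem_evenSets.2 ⟨?_, fun _ => h4⟩
          have h5 := h4.size_eq
          rw [size_even hd (Nat.one_le_iff_ne_zero.2 h3),
            size_leafInduced _ (mem_usedBranches.1 hj)] at h5
          exact h5
        · rw [h2 (Fin.castLE hn j), mem_evenSets_zero, ← Finset.not_nonempty_iff_eq_empty,
            ← mem_usedBranches]
          · exact hj
          · rintro ⟨l, hl⟩
            have : (usedBranches S).orderEmbOfFin rfl l = j := by
              simpa using hl
            exact hj (this ▸ Finset.orderEmbOfFin_mem _ rfl l)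
  · rintro (⟨i, hi⟩ | ⟨B, ⟨hB, h0⟩, hj⟩)
    · have hc : ∀ j, (branchPart S j).card = if j = i then d * s + b else 0 :=
        fun j => (mem_evenSets.1 (hi j)).1
      have hu : usedBranches S = {i} := by
        ext j
        rw [mem_usedBranches, Finset.mem_singleton, ← Finset.card_pos, hc]
        split_ifs with h
        · simp only [h, iff_true]; omega
        · simp [h]
      have h1 := mem_evenSets.1 (hi i)
      rw [if_pos rfl] at h1
      refine mem_evenSets.2 ⟨?_, fun _ => ?_⟩
      · rw [card_eq_sum_branchPart, Finset.sum_congr rfl fun j _ => hc j]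
        simp
      · rw [leafInduced_node_of_usedBranches_eq_singleton hu]
        refine h1.2 ?_
        rw [← Finset.card_pos]
        omega
    · have hc : ∀ j, (branchPart S j).card = balancedPart s B (Fin.castLE hn j) :=
        fun j => (mem_evenSets.1 (hj j)).1
      have hcard : S.card = d * s + b := by
        rw [card_eq_sum_branchPart, Finset.sum_congr rfl fun j _ => hc j, ← hB,
          ← sum_balancedPart s B]
        refine Finset.sum_of_injOn (Fin.castLE hn) (Fin.castLE_injective hn).injOn (by simp)
          (fun i _ hi => h0 i ?_) fun _ _ => rfl
        by_contra hlt
        exact hi ⟨⟨i, by omega⟩, by simp, rfl⟩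
      have hu : (usedBranches S).card ≠ 1 := by
        intro hu
        obtain ⟨i, hi⟩ := Finset.card_eq_one.1 hu
        have h1 : S.card = (branchPart S i).card := by
          rw [card_eq_sum_branchPart, Finset.sum_eq_single i]
          · intro l _ hl
            rw [Finset.card_eq_zero, ← Finset.not_nonempty_iff_eq_empty, ← mem_usedBranches, hi]
            simpa using hl
          · simp
        have h2 := balancedPart_lt hd hk hB (Fin.castLE hn i)
        rw [← hc, ← h1] at h2
        omega
      refine mem_evenSets.2 ⟨hcard, fun _ => ?_⟩
      rw [leafInduced_node_of_card_usedBranches_ne_one hu, iso_even_iff hd hb hk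
          (((usedBranches S).orderEmbOfFin rfl).toEmbedding.trans (Fin.castLEEmb hn))]
      refine ⟨B, hB, fun l => ?_, fun i hi => ?_⟩
      · have hl := mem_usedBranches.1 (Finset.orderEmbOfFin_mem (usedBranches S) rfl l)
        refine ⟨?_, (mem_evenSets.1 (hj _)).2 hl⟩
        have := hc ((usedBranches S).orderEmbOfFin rfl l)
        have h3 := hl.card_pos
        simp only [Function.Embedding.trans_apply, Fin.castLEEmb_apply, RelEmbedding.coe_toEmbedding]
        omega
      · rcases le_or_gt n i with hni | hni
        · exact h0 i hni
        · have h3 : (⟨i, hni⟩ : Fin n) ∉ usedBranches S := by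
            intro hmem
            have : (⟨i, hni⟩ : Fin n) ∈ Set.range ((usedBranches S).orderEmbOfFin rfl) := by
              rw [Finset.range_orderEmbOfFin]
              exact hmem
            obtain ⟨l, hl⟩ := this
            refine hi ⟨l, ?_⟩
            simp [hl]
          rw [mem_usedBranches, ← Finset.card_pos, hc] at h3
          simp only [Fin.castLE_mk, Fin.eta] at h3
          omega

/-- The number of sets of leaves whose parts in the branches are even of prescribed sizes. -/
theorem card_filter_branchPart_mem {d n : ℕ} (c : Fin n → RTree) (p : Fin n → ℕ)
    [DecidablePred fun S : Finset (node n c).Leaves => ∀ j, branchPart S j ∈ evenSets d (c j) (p j)] :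
    (Finset.univ.filter fun S : Finset (node n c).Leaves =>
      ∀ j, branchPart S j ∈ evenSets d (c j) (p j)).card = ∏ j, (evenSets d (c j) (p j)).card := by
  rw [← Fintype.card_piFinset]
  refine Finset.card_equiv (branchEquiv c) fun S => ?_
  rw [Finset.mem_filter, Fintype.mem_piFinset, and_iff_right (Finset.mem_univ S)]
  rfl

/-- The recursion for the number of even sets of leaves, sorted by their distribution over the
branches. -/
theorem card_evenSets_node {d s b n : ℕ} (hd : 2 ≤ d) (hb : b < d) (hk : 2 ≤ d * s + b)
    (hn : n ≤ d) (c : Fin n → RTree) :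
    (evenSets d (node n c) (d * s + b)).card =
      ∑ i, (evenSets d (c i) (d * s + b)).card +
      ∑ B ∈ (Finset.powersetCard b Finset.univ).filter
          (fun B : Finset (Fin d) => ∀ i : Fin d, n ≤ i → balancedPart s B i = 0),
        ∏ j, (evenSets d (c j) (balancedPart s B (Fin.castLE hn j))).card := by
  classical
  let F : (Fin n → ℕ) → Finset (Finset (node n c).Leaves) := fun p =>
    Finset.univ.filter fun S => ∀ j, branchPart S j ∈ evenSets d (c j) (p j)
  have hF : ∀ p S, S ∈ F p ↔ ∀ j, branchPart S j ∈ evenSets d (c j) (p j) := fun p S => by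
    simp [F]
  have hdisj : ∀ p q, p ≠ q → Disjoint (F p) (F q) := by
    intro p q hpq
    rw [Finset.disjoint_left]
    intro S hp hq
    refine hpq (funext fun j => ?_)
    rw [← (mem_evenSets.1 ((hF p S).1 hp j)).1, (mem_evenSets.1 ((hF q S).1 hq j)).1]
  let I : Finset (Finset (Fin d)) := (Finset.powersetCard b Finset.univ).filter
    (fun B : Finset (Fin d) => ∀ i : Fin d, n ≤ i → balancedPart s B i = 0)
  have hI : ∀ B, B ∈ I ↔ B.card = b ∧ ∀ i : Fin d, n ≤ i → balancedPart s B i = 0 := fun B => by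
    simp [I, Finset.mem_powersetCard]
  -- The size distributions of the sets inside branch `i`, and of the sets that split at the root.
  let p₁ : Fin n → Fin n → ℕ := fun i j => if j = i then d * s + b else 0
  let p₂ : Finset (Fin d) → Fin n → ℕ := fun B j => balancedPart s B (Fin.castLE hn j)
  have hunion : evenSets d (node n c) (d * s + b) =
      Finset.univ.biUnion (fun i => F (p₁ i)) ∪ I.biUnion (fun B => F (p₂ B)) := by
    ext S
    rw [mem_evenSets_node hd hb hk hn]
    simp only [Finset.mem_union, Finset.mem_biUnion, Finset.mem_univ, true_and, hF, hI, p₁, p₂]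
  rw [hunion, Finset.card_union_of_disjoint, Finset.card_biUnion, Finset.card_biUnion]
  · congr 1
    · refine Finset.sum_congr rfl fun i _ => ?_
      rw [card_filter_branchPart_mem, Finset.prod_eq_single i]
      · simp [p₁]
      · intro j _ hj
        simp [p₁, hj, evenSets_zero]
      · simp
    · exact Finset.sum_congr rfl fun B _ => card_filter_branchPart_mem c _
  · intro B hB C hC hBC
    refine hdisj _ _ fun h => hBC ?_
    have h1 := ((hI B).1 hB).2
    have h2 := ((hI C).1 hC).2
    have : balancedPart s B = balancedPart s C := by
      funext i
      rcases le_or_gt n i with hni | hni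
      · rw [h1 i hni, h2 i hni]
      · exact congrFun h ⟨i, hni⟩
    ext i
    have := congrFun this i
    simp only [balancedPart] at this
    split_ifs at this with h3 h4 h4
    · simp [h3, h4]
    · omega
    · omega
    · simp [h3, h4]
  · intro i _ j _ hij
    refine hdisj _ _ fun h => hij ?_
    have := congrFun h i
    simp only [p₁, if_true] at this
    split_ifs at this with h3
    · exact h3
    · omega
  · rw [Finset.disjoint_biUnion_left]
    intro i _
    rw [Finset.disjoint_biUnion_right]
    intro B hB
    refine hdisj _ _ fun h => ?_
    have h1 := congrFun h i
    have h2 := balancedPart_lt hd hk ((hI B).1 hB).1 (Fin.castLE hn i)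
    simp only [p₁, p₂, if_true] at h1
    omega

end RTree

/-! ### The upper bound -/

theorem pow_sub_self_pos {d k : ℕ} (hd : 2 ≤ d) (hk : 2 ≤ k) : (0 : ℝ) < (d : ℝ) ^ k - d := by
  have h : (1 : ℝ) < d := by exact_mod_cast hd
  have := pow_lt_pow_right₀ h (by omega : 1 < k)
  rw [pow_one] at this
  linarith

theorem exists_eq_mul_add {d : ℕ} (hd : 2 ≤ d) (k : ℕ) : ∃ s b, b < d ∧ k = d * s + b :=
  ⟨k / d, k % d, Nat.mod_lt _ (by omega), (Nat.div_add_mod k d).symm⟩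

open RTree

theorem evenConst_eq_prod {d s b : ℕ} (hd : 2 ≤ d) (hb : b < d) (hk : 2 ≤ d * s + b)
    {B : Finset (Fin d)} (hB : B.card = b) :
    evenConst d (d * s + b) = (d.choose b : ℝ) * (∏ i, evenConst d (balancedPart s B i)) /
      ((d : ℝ) ^ (d * s + b) - d) := by
  rw [evenConst_rec d s b hd hb hk, prod_balancedPart hB]

theorem evenConst_nonneg {d : ℕ} (hd : 2 ≤ d) (k : ℕ) : 0 ≤ evenConst d k := by
  induction k using Nat.strong_induction_on with
  | _ k ih =>
    rcases lt_or_ge k 2 with hk | hk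
    · interval_cases k
      · rw [evenConst_zero]; exact zero_le_one
      · rw [evenConst_one]; exact zero_le_one
    · obtain ⟨s, b, hb, rfl⟩ := exists_eq_mul_add hd k
      obtain ⟨B, hB⟩ := exists_finset_card_eq hb
      rw [evenConst_eq_prod hd hb hk hB]
      have h1 := pow_sub_self_pos hd hk
      have h2 : 0 ≤ ∏ i, evenConst d (balancedPart s B i) :=
        Finset.prod_nonneg fun i _ => ih _ (balancedPart_lt hd hk hB i)
      positivity

namespace RTree

/-- The upper bound, exact in the size of the tree. -/
theorem card_evenSets_le {d : ℕ} (hd : 2 ≤ d) (k : ℕ) (T : RTree) (hT : T.IsDary d) :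
    ((evenSets d T k).card : ℝ) ≤ evenConst d k * (T.size : ℝ) ^ k := by
  induction k using Nat.strong_induction_on generalizing T with
  | _ k ih =>
    rcases lt_or_ge k 2 with hk | hk
    · interval_cases k
      · simp [evenSets_zero, evenConst_zero]
      · simp [card_evenSets_one, evenConst_one]
    obtain ⟨s, b, hb, rfl⟩ := exists_eq_mul_add hd k
    obtain ⟨B₀, hB₀⟩ := exists_finset_card_eq hb
    induction T with
    | leaf =>
      rw [evenSets_leaf d hk, Finset.card_empty, Nat.cast_zero]
      exact mul_nonneg (evenConst_nonneg hd _) (by positivity)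
    | node n c ihT =>
      rw [IsDary] at hT
      obtain ⟨-, hn, hc⟩ := hT
      -- The sizes of the branches, extended by zeros to `d` branches.
      let x : Fin d → ℝ := fun i => if h : (i : ℕ) < n then ((c ⟨i, h⟩).size : ℝ) else 0
      have hx : ∀ i, 0 ≤ x i := fun i => by
        simp only [x]
        split_ifs
        · positivity
        · exact le_rfl
      have hxc : ∀ j, x (Fin.castLE hn j) = (c j).size := fun j => by simp [x]
      have hx0 : ∀ i : Fin d, n ≤ i → x i = 0 := fun i hi => by
        simp only [x]
        rw [dif_neg (by omega)]
      have hrange : ∀ i : Fin d, i ∉ Fin.castLE hn '' (Finset.univ : Finset (Fin n)) → n ≤ i := by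
        intro i hi
        by_contra hlt
        exact hi ⟨⟨i, by omega⟩, by simp, rfl⟩
      have hsum : ∀ m, m ≠ 0 → ∑ j, ((c j).size : ℝ) ^ m = ∑ i, x i ^ m := by
        intro m hm
        refine Finset.sum_of_injOn (Fin.castLE hn) (Fin.castLE_injective hn).injOn (by simp)
          (fun i _ hi => ?_) fun j _ => by rw [hxc]
        rw [hx0 i (hrange i hi), zero_pow hm]
      have hsum1 := hsum 1 one_ne_zero
      simp only [pow_one] at hsum1
      set P : ℝ := ∏ i, evenConst d (balancedPart s B₀ i) with hP
      have hP0 : 0 ≤ P := Finset.prod_nonneg fun i _ => evenConst_nonneg hd _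
      have hPB : ∀ B : Finset (Fin d), B.card = b → ∏ i, evenConst d (balancedPart s B i) = P :=
        fun B hB => by rw [hP, prod_balancedPart hB, prod_balancedPart hB₀]
      have hroot : ∑ B ∈ (Finset.powersetCard b Finset.univ).filter
          (fun B : Finset (Fin d) => ∀ i : Fin d, n ≤ i → balancedPart s B i = 0),
          ∏ j, ((evenSets d (c j) (balancedPart s B (Fin.castLE hn j))).card : ℝ) ≤
          P * ∑ B ∈ Finset.powersetCard b Finset.univ, ∏ i, x i ^ balancedPart s B i := by
        rw [Finset.mul_sum]
        refine (Finset.sum_le_sum fun B hB => ?_).trans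
          (Finset.sum_le_sum_of_subset_of_nonneg (Finset.filter_subset _ _) fun B _ _ =>
            mul_nonneg hP0 (Finset.prod_nonneg fun i _ => pow_nonneg (hx i) _))
        rw [Finset.mem_filter, Finset.mem_powersetCard] at hB
        obtain ⟨⟨-, hB⟩, h0⟩ := hB
        rw [← hPB B hB, ← Finset.prod_mul_distrib]
        refine (Finset.prod_le_prod (fun _ _ => Nat.cast_nonneg _) fun j _ =>
          ih _ (balancedPart_lt hd hk hB _) (c j) (hc j)).trans (le_of_eq ?_)
        refine Finset.prod_of_injOn (Fin.castLE hn) (Fin.castLE_injective hn).injOn (by simp)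
          (fun i _ hi => ?_) fun j _ => by rw [hxc]
        rw [h0 i (hrange i hi), evenConst_zero, pow_zero, mul_one]
      have hbranch : ∑ j, ((evenSets d (c j) (d * s + b)).card : ℝ) ≤
          evenConst d (d * s + b) * ∑ i, x i ^ (d * s + b) := by
        rw [← hsum _ (by omega), Finset.mul_sum]
        exact Finset.sum_le_sum fun j _ => ihT j (hc j)
      have hmean := balanced_mean_le (s := s) hb (by omega) hx
      have hD := pow_sub_self_pos hd hk
      have hroot2 : P * ∑ B ∈ Finset.powersetCard b Finset.univ, ∏ i, x i ^ balancedPart s B i ≤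
          evenConst d (d * s + b) * ((∑ i, x i) ^ (d * s + b) - ∑ i, x i ^ (d * s + b)) := by
        rw [evenConst_eq_prod hd hb hk hB₀, ← hP, div_mul_eq_mul_div,
          le_div_iff₀ hD]
        have := mul_le_mul_of_nonneg_left hmean hP0
        linarith
      rw [card_evenSets_node hd hb hk hn, size_node]
      push_cast
      rw [hsum1]
      linarith

/-! ### Complete trees -/

/-- The complete `d`-ary tree of height `h`. -/
def complete (d : ℕ) : ℕ → RTree
  | 0 => leaf
  | h + 1 => node d fun _ => complete d h

theorem isDary_complete {d : ℕ} (hd : 2 ≤ d) (h : ℕ) : (complete d h).IsDary d := by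
  induction h with
  | zero => trivial
  | succ h ih => exact ⟨hd, le_rfl, fun _ => ih⟩

theorem size_complete (d h : ℕ) : (complete d h).size = d ^ h := by
  induction h with
  | zero => rfl
  | succ h ih => rw [complete, size_node]; simp [ih, pow_succ']

end RTree

/-- A linear recursion with contraction factor `q` converges to its fixed point, also when the
inhomogeneous term is only asymptotically constant. -/
theorem tendsto_of_linear_recursion {q L : ℝ} (hq0 : 0 ≤ q) (hq1 : q < 1) {u v : ℕ → ℝ}
    (huv : ∀ n, u (n + 1) = q * u n + v n)
    (hv : Filter.Tendsto v Filter.atTop (nhds ((1 - q) * L))) :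
    Filter.Tendsto u Filter.atTop (nhds L) := by
  rw [Metric.tendsto_atTop] at hv ⊢
  intro ε hε
  obtain ⟨N, hN⟩ := hv ((1 - q) * (ε / 2)) (mul_pos (by linarith) (by linarith))
  have hbound : ∀ m, |u (N + m) - L| ≤ q ^ m * |u N - L| + ε / 2 := by
    intro m
    induction m with
    | zero => simp; linarith
    | succ m ih =>
      have h1 : u (N + (m + 1)) - L = q * (u (N + m) - L) + (v (N + m) - (1 - q) * L) := by
        rw [← add_assoc, huv]
        ring
      have h2 := hN (N + m) (by omega)
      rw [Real.dist_eq] at h2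
      rw [h1]
      refine (abs_add_le _ _).trans ?_
      rw [abs_mul, abs_of_nonneg hq0, pow_succ]
      nlinarith [mul_le_mul_of_nonneg_left ih hq0]
  have hpow : Filter.Tendsto (fun m : ℕ => q ^ m * |u N - L|) Filter.atTop (nhds 0) := by
    simpa using (tendsto_pow_atTop_nhds_zero_of_lt_one hq0 hq1).mul_const |u N - L|
  obtain ⟨M, hM⟩ := Filter.eventually_atTop.1 (hpow.eventually_lt_const (by linarith : 0 < ε / 2))
  refine ⟨N + M, fun n hn => ?_⟩
  obtain ⟨m, rfl⟩ := Nat.exists_eq_add_of_le (by omega : N ≤ n)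
  rw [Real.dist_eq]
  have := hM m (by omega)
  have := hbound m
  linarith

/-- Complete trees attain the upper bound asymptotically. -/
theorem tendsto_card_evenSets_complete {d : ℕ} (hd : 2 ≤ d) (k : ℕ) :
    Filter.Tendsto (fun h => ((evenSets d (complete d h) k).card : ℝ) / ((d : ℝ) ^ h) ^ k)
      Filter.atTop (nhds (evenConst d k)) := by
  have hd0 : (0 : ℝ) < d := by exact_mod_cast (by omega : 0 < d)
  induction k using Nat.strong_induction_on with
  | _ k ih =>
    rcases lt_or_ge k 2 with hk | hk
    · interval_cases k
      · simp [evenSets_zero, evenConst_zero]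
      · have : ∀ h, (d : ℝ) ^ h ≠ 0 := fun h => (pow_pos hd0 h).ne'
        simp [card_evenSets_one, evenConst_one, size_complete, this]
    obtain ⟨s, b, hb, rfl⟩ := exists_eq_mul_add hd k
    have hD := pow_sub_self_pos hd hk
    have hdk : (0 : ℝ) < (d : ℝ) ^ (d * s + b) := pow_pos hd0 _
    -- Sorting by branches gives `u (h + 1) = d ^ (1 - k) * u h + v h`; `hv` is the limit of `v`.
    have hv := (tendsto_finsetSum (Finset.powersetCard b (Finset.univ : Finset (Fin d)))
      fun B hB => tendsto_finsetProd Finset.univ fun i _ =>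
        ih _ (balancedPart_lt hd hk (Finset.mem_powersetCard.1 hB).2 i)).div_const
          ((d : ℝ) ^ (d * s + b))
    refine tendsto_of_linear_recursion (q := d / (d : ℝ) ^ (d * s + b)) (by positivity)
      ((div_lt_one hdk).2 (by linarith)) (fun h => ?_) (hv.trans (le_of_eq ?_))
    · have hN : (0 : ℝ) < (d : ℝ) ^ h := pow_pos hd0 h
      have hprod : ∀ B ∈ Finset.powersetCard b (Finset.univ : Finset (Fin d)),
          ∏ i, ((evenSets d (complete d h) (balancedPart s B i)).card : ℝ) /
            ((d : ℝ) ^ h) ^ balancedPart s B i =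
          (∏ i, ((evenSets d (complete d h) (balancedPart s B i)).card : ℝ)) /
            ((d : ℝ) ^ h) ^ (d * s + b) := by
        intro B hB
        rw [Finset.prod_div_distrib, Finset.prod_pow_eq_pow_sum, sum_balancedPart,
          (Finset.mem_powersetCard.1 hB).2]
      rw [Finset.sum_congr rfl hprod, ← Finset.sum_div, complete,
        card_evenSets_node hd hb hk le_rfl, Finset.filter_true_of_mem]
      · push_cast
        simp only [Fin.castLE_rfl, id, Finset.sum_const, Finset.card_univ, Fintype.card_fin,
          nsmul_eq_mul]
        rw [pow_succ, mul_pow]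
        field_simp
      · intro B _ i hi
        exact absurd i.2 (by omega)
    · -- The recursion for `evenConst` says that it is the fixed point.
      congr 1
      obtain ⟨B₀, hB₀⟩ := exists_finset_card_eq hb
      have h1 : ∀ B ∈ Finset.powersetCard b (Finset.univ : Finset (Fin d)),
          ∏ i, evenConst d (balancedPart s B i) = ∏ i, evenConst d (balancedPart s B₀ i) := by
        intro B hB
        rw [prod_balancedPart (Finset.mem_powersetCard.1 hB).2, prod_balancedPart hB₀]
      rw [Finset.sum_congr rfl h1, evenConst_eq_prod hd hb hk hB₀, Finset.sum_const,
        Finset.card_powersetCard, Finset.card_univ, Fintype.card_fin, nsmul_eq_mul]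
      have hD' := hD.ne'
      field_simp

/-! ### Densities and the limit superior -/

theorem tendsto_pow_div_choose (k : ℕ) :
    Filter.Tendsto (fun n : ℕ => (n : ℝ) ^ k / (n.choose k : ℝ)) Filter.atTop
      (nhds (k.factorial : ℝ)) := by
  have h0 : ∀ᶠ n : ℕ in Filter.atTop, (n.choose k : ℝ) ≠ 0 := by
    filter_upwards [Filter.eventually_ge_atTop k] with n hn
    exact_mod_cast (Nat.choose_pos hn).ne'
  have h1 := (Asymptotics.isEquivalent_iff_tendsto_one h0).1 (isEquivalent_choose k).symm
  have h2 := h1.const_mul (k.factorial : ℝ)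
  rw [mul_one] at h2
  refine h2.congr fun n => ?_
  have : (k.factorial : ℝ) ≠ 0 := by exact_mod_cast k.factorial_ne_zero
  simp only [Pi.div_apply]
  field_simp

theorem density_even_le {d k : ℕ} (hd : 2 ≤ d) (hk : 1 ≤ k) {T : RTree} (hT : T.IsDary d) :
    density (even d k) T ≤ evenConst d k * ((T.size : ℝ) ^ k / (T.size.choose k : ℝ)) := by
  rw [density, size_even hd hk, copies_even hd hk, mul_div_assoc']
  exact div_le_div_of_nonneg_right (card_evenSets_le hd k T hT) (Nat.cast_nonneg _)

theorem maxDensity_even_le {d k : ℕ} (hd : 2 ≤ d) (hk : 1 ≤ k) (n : ℕ) :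
    maxDensity d (even d k) n ≤ evenConst d k * ((n : ℝ) ^ k / (n.choose k : ℝ)) := by
  refine Real.sSup_le ?_ (mul_nonneg (evenConst_nonneg hd k) (by positivity))
  rintro _ ⟨T, hT, rfl, rfl⟩
  exact density_even_le hd hk hT

theorem density_le_maxDensity_even {d k : ℕ} (hd : 2 ≤ d) (hk : 1 ≤ k) {T : RTree}
    (hT : T.IsDary d) : density (even d k) T ≤ maxDensity d (even d k) T.size := by
  refine le_csSup ⟨evenConst d k * ((T.size : ℝ) ^ k / (T.size.choose k : ℝ)), ?_⟩
    ⟨T, hT, rfl, rfl⟩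
  rintro _ ⟨U, hU, hUT, rfl⟩
  rw [← hUT]
  exact density_even_le hd hk hU

theorem maxDensity_nonneg (d : ℕ) (D : RTree) (n : ℕ) : 0 ≤ maxDensity d D n := by
  refine Real.sSup_nonneg ?_
  rintro _ ⟨T, -, -, rfl⟩
  exact div_nonneg (Nat.cast_nonneg _) (Nat.cast_nonneg _)

theorem theorem1 (d k : ℕ) (hd : 2 ≤ d) (hk : 1 ≤ k) :
    RTree.inducibility d (RTree.even d k) = (k.factorial : ℝ) * evenConst d k := by
  have hr := (tendsto_pow_div_choose k).const_mul (evenConst d k)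
  rw [mul_comm]
  have hle : ∀ᶠ n in Filter.atTop, maxDensity d (even d k) n ≤
      evenConst d k * ((n : ℝ) ^ k / (n.choose k : ℝ)) :=
    Filter.Eventually.of_forall (maxDensity_even_le hd hk)
  have hbdd := hr.isBoundedUnder_le.mono_le hle
  apply le_antisymm
  · rw [← hr.limsup_eq]
    exact Filter.limsup_le_limsup hle
      (Filter.isBoundedUnder_of ⟨0, maxDensity_nonneg d _⟩).isCoboundedUnder_le
      hr.isBoundedUnder_le
  · refine le_of_forall_lt fun y hy => ?_
    obtain ⟨z, hyz, hz⟩ := exists_between hy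
    refine hyz.trans_le (Filter.le_limsup_of_frequently_le ?_ hbdd)
    -- The complete trees, of sizes `d ^ h`, have densities tending to the claimed value.
    have hpow : Filter.Tendsto (fun h : ℕ => d ^ h) Filter.atTop Filter.atTop :=
      tendsto_pow_atTop_atTop_of_one_lt (by omega)
    have hlim := (tendsto_card_evenSets_complete hd k).mul ((tendsto_pow_div_choose k).comp hpow)
    refine hpow.frequently (Filter.Eventually.frequently ?_)
    filter_upwards [hlim.eventually_const_lt hz] with h hh
    rw [← size_complete d h]
    refine le_trans (hh.le.trans (le_of_eq ?_))
      (density_le_maxDensity_even hd hk (isDary_complete hd h))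
    have hd0 : ((d : ℝ) ^ h) ^ k ≠ 0 :=
      pow_ne_zero _ (pow_ne_zero _ (by exact_mod_cast (by omega : d ≠ 0)))
    rw [density, size_even hd hk, copies_even hd hk, size_complete]
    simp only [Function.comp_apply]
    push_cast
    field_simp
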